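/- Let $n\ge 0$, $a=(a_1,\dots,a_n)$ with all $a_i>0$, and let $k>0$ be real. Write $\mathcal E_a=\{z\in\mathbb C^n : \sum_i |z_i|^2/a_i<1\}$, let $\mathbb D\subset\mathbb C$ be the open unit disc with polar coordinates $w=re^{i\theta}$, and let $\omega_{st}=\sum_i d(r_i^2)\wedge d\theta_i=2\sum_i dx_i\wedge dy_i$ be the standard symplectic form on $\mathbb C^n$ (respectively on $\mathbb C^{n+1}$), where $z_i=r_ie^{i\theta_i}=x_i+iy_i$. Let $\pi:\mathcal E_a\times\mathbb D\to\mathcal E_a$ be the projection, and let $\alpha$ be any smooth real $1$-form on $\mathcal E_a\times(\mathbb D\setminus\{0\})$ such that $d\alpha=-\pi^*\omega_{st}$ and, for every $z\in\mathcal E_a$, the restriction of $\alpha$ to $\{z\}\times(\mathbb D\setminus\{0\})$ is $\frac1k\,d\theta$. Then the form $r^2\alpha$, extended by $0$ along $\{w=0\}$, is smooth on $\mathcal E_a\times\mathbb D$, the form $\omega:=\pi^*\omega_{st}+d(r^2\alpha)$ is a symplectic form on $\mathcal E_a\times\mathbb D$, and there is a smooth function $h:\mathcal E_a\to\mathbb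 R$ such that $$\Phi(z,w)=\Big(\sqrt{1-|w|^2}\;z,\ \tfrac1{\sqrt k}\,e^{ih(z)}\,w\Big)$$ is a symplectomorphism (a smooth diffeomorphism with $\Phi^*\omega_{st}=\omega$) from $(\mathcal E_a\times\mathbb D,\omega)$ onto $(\mathcal E_{(a,1/k)},\omega_{st})$, where $\mathcal E_{(a,1/k)}=\{(z,w)\in\mathbb C^{n+1} : \sum_i|z_i|^2/a_i+k|w|^2<1\}$. -/

import Mathlib

open scoped ContDiff

namespace DiscBundle

noncomputable section

/-- The wedge product of two real covectors, `(f ∧ g)(u, v) = f u * g v - f v * g u`. -/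
def wedge {E : Type*} [NormedAddCommGroup E] [NormedSpace ℝ E] (f g : E →L[ℝ] ℝ) :
    E [⋀^Fin 2]→L[ℝ] ℝ :=
  ContinuousMultilinearMap.alternatization
    ((ContinuousMultilinearMap.mkPiAlgebra ℝ (Fin 2) ℝ).compContinuousLinearMap ![f, g])

theorem wedge_apply {E : Type*} [NormedAddCommGroup E] [NormedSpace ℝ E] (f g : E →L[ℝ] ℝ)
    (v : Fin 2 → E) : wedge f g v = f (v 0) * g (v 1) - f (v 1) * g (v 0) := by
  have h : (Finset.univ : Finset (Equiv.Perm (Fin 2))) = {1, Equiv.swap 0 1} := by decide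
  have h' : (1 : Equiv.Perm (Fin 2)) ∉ ({Equiv.swap 0 1} : Finset (Equiv.Perm (Fin 2))) := by
    decide
  rw [wedge, ContinuousMultilinearMap.alternatization_apply_apply, h, Finset.sum_insert h',
    Finset.sum_singleton]
  simp [Fin.prod_univ_two, sub_eq_add_neg]

/-- The real linear coordinate `x_i = Re z_i` on `ℂⁿ`. -/
def reCoord {n : ℕ} (i : Fin n) : (Fin n → ℂ) →L[ℝ] ℝ :=
  Complex.reCLM.comp (ContinuousLinearMap.proj (R := ℝ) (φ := fun _ : Fin n => ℂ) i)

/-- The real linear coordinate `y_i = Im z_i` on `ℂⁿ`. -/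
def imCoord {n : ℕ} (i : Fin n) : (Fin n → ℂ) →L[ℝ] ℝ :=
  Complex.imCLM.comp (ContinuousLinearMap.proj (R := ℝ) (φ := fun _ : Fin n => ℂ) i)

/-- The standard symplectic form `∑ d(r_i²) ∧ dθ_i = 2 ∑ dx_i ∧ dy_i` on `ℂⁿ`, in polar
coordinates `z_i = r_i e^{iθ_i}`. It has constant coefficients, so it is given by its value at
one point. -/
def stdForm (n : ℕ) : (Fin n → ℂ) [⋀^Fin 2]→L[ℝ] ℝ :=
  ∑ i : Fin n, (2 : ℝ) • wedge (reCoord i) (imCoord i)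

theorem stdForm_apply (n : ℕ) (v : Fin 2 → Fin n → ℂ) :
    stdForm n v
      = ∑ i, 2 * ((v 0 i).re * (v 1 i).im - (v 1 i).re * (v 0 i).im) := by
  simp [stdForm, wedge_apply, reCoord, imCoord]

/-- The open ellipsoid `{z ∈ ℂⁿ | ∑ |z_i|² / a_i < 1}`. -/
def ellipsoid {n : ℕ} (a : Fin n → ℝ) : Set (Fin n → ℂ) :=
  {z | ∑ i, ‖z i‖ ^ 2 / a i < 1}

/-- The open unit disc of `ℂ`. -/
def disc : Set ℂ := Metric.ball 0 1

/-- The ambient vector space `ℂⁿ × ℂ` of the total space of the trivial disc bundle. -/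
abbrev Total (n : ℕ) : Type := (Fin n → ℂ) × ℂ

/-- The angular form `dθ` on `ℂ ∖ {0}`: at `w` it maps the tangent vector `η` to `Im (η / w)`. -/
def angularForm (w : ℂ) : ℂ [⋀^Fin 1]→L[ℝ] ℝ :=
  ContinuousAlternatingMap.ofSubsingleton ℝ ℂ ℝ (0 : Fin 1)
    (Complex.imCLM.comp (ContinuousLinearMap.mul ℝ ℂ w⁻¹))

theorem angularForm_apply (w : ℂ) (v : Fin 1 → ℂ) : angularForm w v = (w⁻¹ * v 0).im := by
  simp [angularForm]

/-- The pull-back `π^*ω_st` of the standard form by the projection `π : (z, w) ↦ z`. -/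
def pullStdForm (n : ℕ) : Total n [⋀^Fin 2]→L[ℝ] ℝ :=
  (stdForm n).compContinuousLinearMap (ContinuousLinearMap.fst ℝ (Fin n → ℂ) ℂ)

/-- The restriction of a `1`-form `α` on the total space to the fibre `{z} × ℂ`, at the
point `w`. -/
def fibreRestrict {n : ℕ} (α : Total n → Total n [⋀^Fin 1]→L[ℝ] ℝ) (z : Fin n → ℂ) (w : ℂ) :
    ℂ [⋀^Fin 1]→L[ℝ] ℝ :=
  (α (z, w)).compContinuousLinearMap (ContinuousLinearMap.inr ℝ (Fin n → ℂ) ℂ)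

/-- `α` is a smooth `1`-form on the complement `U × (𝔻 ∖ {0})` of the zero section, with
`α|_{{z} × 𝔻} = (1/k) dθ` and `dα = -π^*ω_st`. Its values elsewhere are irrelevant. -/
structure IsAdmissible {n : ℕ} (U : Set (Fin n → ℂ)) (k : ℝ)
    (α : Total n → Total n [⋀^Fin 1]→L[ℝ] ℝ) : Prop where
  smooth : ContDiffOn ℝ ∞ α (U ×ˢ (disc \ {0}))
  restrict : ∀ z ∈ U, ∀ w ∈ disc \ {0}, fibreRestrict α z w = (1 / k) • angularForm w
  d_eq : ∀ p ∈ U ×ˢ (disc \ {0}), extDeriv α p = -pullStdForm n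

/-- The `1`-form `r²α`, where `r = |w|`; it is `0` along the zero section `w = 0`. -/
def radialForm {n : ℕ} (α : Total n → Total n [⋀^Fin 1]→L[ℝ] ℝ) :
    Total n → Total n [⋀^Fin 1]→L[ℝ] ℝ :=
  fun p => ‖p.2‖ ^ 2 • α p

/-- The `2`-form `ω = π^*ω_st + d(r²α)`. -/
def bundleForm {n : ℕ} (α : Total n → Total n [⋀^Fin 1]→L[ℝ] ℝ) :
    Total n → Total n [⋀^Fin 2]→L[ℝ] ℝ :=
  fun p => pullStdForm n + extDeriv (radialForm α) p

/-- `τ` is a symplectic form on the open set `U`: smooth, closed and nondegenerate. -/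
structure IsSymplecticOn {E : Type*} [NormedAddCommGroup E] [NormedSpace ℝ E]
    (τ : E → E [⋀^Fin 2]→L[ℝ] ℝ) (U : Set E) : Prop where
  smooth : ContDiffOn ℝ ∞ τ U
  closed : ∀ p ∈ U, extDeriv τ p = 0
  nondegenerate : ∀ p ∈ U, ∀ u : E, (∀ v : E, τ p ![u, v] = 0) → u = 0

/-- `Φ` is a symplectomorphism from the open set `U` with the form `τ` onto the open set `V` with
the form `σ`: a smooth bijection `U → V` with smooth inverse, such that `Φ^*σ = τ`. -/
structure IsSymplectomorphism {E F : Type*} [NormedAddCommGroup E] [NormedSpace ℝ E]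
    [NormedAddCommGroup F] [NormedSpace ℝ F] (U : Set E) (τ : E → E [⋀^Fin 2]→L[ℝ] ℝ)
    (V : Set F) (σ : F → F [⋀^Fin 2]→L[ℝ] ℝ) (Φ : E → F) : Prop where
  bijOn : Set.BijOn Φ U V
  smooth : ContDiffOn ℝ ∞ Φ U
  smooth_inverse : ∃ Ψ : F → E, Set.InvOn Ψ Φ U V ∧ ContDiffOn ℝ ∞ Ψ V
  pullback : ∀ p ∈ U, (σ (Φ p)).compContinuousLinearMap (fderiv ℝ Φ p) = τ p

/-- The map `Φ(z, w) = (√(1 - |w|²) z, k^{-1/2} e^{i h(z)} w)` from `ℂⁿ × ℂ` to `ℂⁿ⁺¹`. -/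
def bundleMap {n : ℕ} (k : ℝ) (h : (Fin n → ℂ) → ℝ) : Total n → (Fin (n + 1) → ℂ) :=
  fun p => Fin.snoc (α := fun _ => ℂ)
    (fun i => ((√(1 - ‖p.2‖ ^ 2) : ℝ) : ℂ) * p.1 i)
    (((1 / √k : ℝ) : ℂ) * Complex.exp (Complex.I * (h p.1 : ℂ)) * p.2)

end

end DiscBundle

/-! Write λ = ∑ r_i² dθ_i (`liouville`), so dλ = ω_st. The hypotheses force α = β + (1/k) dθ with β
a 1-form on the base and dβ = -ω_st (`IsAdmissible.exists_base_form`). Hence r²α = r²β + (1/k) r²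
dθ, which is smooth across w = 0 because r² dθ = x dy - y dx.

The form β + λ is closed, and the ellipsoid is convex, so dh = k(β + λ) for some smooth h
(`exists_primitive`). For this h, the map Φ pulls λ on ℂⁿ⁺¹ back to (1 - r²)λ + (r²/k)(dθ + dh) = λ
+ r²α, whose differential is ω. The code checks the resulting equality of 2-forms pointwise, by
comparing `bundleForm_apply` with `stdForm_fderiv_bundleMap`.

Φ has an explicit smooth inverse, and nondegeneracy of ω is inherited from ω_st through Φ. -/

namespace DiscBundle

/-! ### Linear algebra of the standard form -/

/-- The bilinear form `(w, η) ↦ Im (conj w * η)` on `ℂ`. -/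
noncomputable def areaForm : ℂ →L[ℝ] ℂ →L[ℝ] ℝ :=
  Complex.reCLM.smulRight Complex.imCLM - Complex.imCLM.smulRight Complex.reCLM

theorem areaForm_apply (w η : ℂ) : areaForm w η = w.re * η.im - w.im * η.re := by
  simp [areaForm]

/-- The real inner product `(w, η) ↦ Re (conj w * η)` on `ℂ`. -/
noncomputable def dotForm : ℂ →L[ℝ] ℂ →L[ℝ] ℝ :=
  Complex.reCLM.smulRight Complex.reCLM + Complex.imCLM.smulRight Complex.imCLM

theorem dotForm_apply (w η : ℂ) : dotForm w η = w.re * η.re + w.im * η.im := by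
  simp [dotForm]

/-- Half of the standard symplectic form as a bilinear map; as a `1`-form
`z ↦ liouville n z = ∑ r_i² dθ_i` it is a primitive of the standard symplectic form. -/
noncomputable def liouville (n : ℕ) : (Fin n → ℂ) →L[ℝ] (Fin n → ℂ) →L[ℝ] ℝ :=
  ∑ i, ((reCoord i).smulRight (imCoord i) - (imCoord i).smulRight (reCoord i))

theorem liouville_apply (n : ℕ) (z ζ : Fin n → ℂ) :
    liouville n z ζ = ∑ i, areaForm (z i) (ζ i) := by
  simp [liouville, areaForm_apply, reCoord, imCoord]

theorem liouville_swap (n : ℕ) (z ζ : Fin n → ℂ) : liouville n z ζ = -liouville n ζ z := by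
  rw [liouville_apply, liouville_apply, ← Finset.sum_neg_distrib]
  exact Finset.sum_congr rfl fun i _ => by rw [areaForm_apply, areaForm_apply]; ring

theorem liouville_self (n : ℕ) (z : Fin n → ℂ) : liouville n z z = 0 := by
  linarith [liouville_swap n z z]

theorem stdForm_eq_liouville (n : ℕ) (v : Fin 2 → Fin n → ℂ) :
    stdForm n v = 2 * liouville n (v 0) (v 1) := by
  rw [stdForm_apply, liouville_apply, Finset.mul_sum]
  exact Finset.sum_congr rfl fun i _ => by rw [areaForm_apply]; ring

theorem stdForm_succ (n : ℕ) (v : Fin 2 → Fin (n + 1) → ℂ) :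
    stdForm (n + 1) v = 2 * liouville n (fun i => v 0 i.castSucc) (fun i => v 1 i.castSucc)
      + 2 * areaForm (v 0 (Fin.last n)) (v 1 (Fin.last n)) := by
  rw [stdForm_eq_liouville, liouville_apply, liouville_apply, Fin.sum_univ_castSucc]
  ring

theorem stdForm_nondegenerate (n : ℕ) (u : Fin n → ℂ) (hu : ∀ v, stdForm n ![u, v] = 0) :
    u = 0 := by
  -- Pairing u with iu gives 2|u|².
  have h := hu (fun i => Complex.I * u i)
  rw [stdForm_eq_liouville, liouville_apply] at h
  have h' : ∑ i, ((u i).re * (u i).re + (u i).im * (u i).im) = 0 := by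
    simpa [areaForm_apply] using h
  rw [Finset.sum_eq_zero_iff_of_nonneg
    fun i _ => add_nonneg (mul_self_nonneg _) (mul_self_nonneg _)] at h'
  funext i
  simpa [Complex.normSq_apply] using Complex.normSq_eq_zero.1
    ((Complex.normSq_apply (u i)).trans (h' i (Finset.mem_univ i)))

/-! ### Exterior derivatives in terms of Fréchet derivatives -/

section OneForms

variable {E : Type*} [NormedAddCommGroup E] [NormedSpace ℝ E]

/-- The identification of covectors with alternating `1`-forms. -/
noncomputable def oneFormEquiv (E : Type*) [NormedAddCommGroup E] [NormedSpace ℝ E] :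
    (E →L[ℝ] ℝ) ≃L[ℝ] E [⋀^Fin 1]→L[ℝ] ℝ :=
  (ContinuousAlternatingMap.ofSubsingletonLIE (0 : Fin 1)).toContinuousLinearEquiv

theorem oneFormEquiv_apply (f : E →L[ℝ] ℝ) (v : Fin 1 → E) : oneFormEquiv E f v = f (v 0) := rfl

theorem extDeriv_oneFormEquiv_apply {A : E → E →L[ℝ] ℝ} {A' : E →L[ℝ] E →L[ℝ] ℝ} {p : E}
    (hA : HasFDerivAt A A' p) (v : Fin 2 → E) :
    extDeriv (fun q => oneFormEquiv E (A q)) p v = A' (v 0) (v 1) - A' (v 1) (v 0) := by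
  have h : HasFDerivAt (fun q => oneFormEquiv E (A q))
      ((oneFormEquiv E).toContinuousLinearMap.comp A') p :=
    (oneFormEquiv E).toContinuousLinearMap.hasFDerivAt.comp p hA
  rw [extDeriv, h.fderiv, ContinuousAlternatingMap.alternatizeUncurryFin_apply]
  simp [Fin.sum_univ_two, Fin.removeNth, sub_eq_add_neg, oneFormEquiv_apply]

theorem contDiffOn_extDeriv {m : ℕ} {τ : E → E [⋀^Fin m]→L[ℝ] ℝ} {s : Set E} (hs : IsOpen s)
    (hτ : ContDiffOn ℝ ∞ τ s) : ContDiffOn ℝ ∞ (extDeriv τ) s := by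
  have h : ContDiff ℝ ∞ (ContinuousAlternatingMap.alternatizeUncurryFinCLM (n := m) ℝ E ℝ) :=
    ContinuousLinearMap.contDiff _
  exact h.comp_contDiffOn ((contDiffOn_infty_iff_fderiv_of_isOpen hs).1 hτ).2

end OneForms

/-! ### Topology and convexity of the domains -/

theorem isPreconnected_disc_diff_zero : IsPreconnected (disc \ {0}) := by
  have h : disc \ {0} = (fun q : ℝ × ℝ => (q.1 : ℂ) * Complex.exp (q.2 * Complex.I)) ''
      (Set.Ioo 0 1 ×ˢ Set.univ) := by
    ext w
    constructor
    · rintro ⟨hw, hw0⟩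
      refine ⟨(‖w‖, w.arg), ⟨⟨norm_pos_iff.2 hw0, by simpa [disc] using hw⟩, trivial⟩, ?_⟩
      exact Complex.norm_mul_exp_arg_mul_I w
    · rintro ⟨q, ⟨⟨h0, h1⟩, -⟩, rfl⟩
      refine ⟨?_, ?_⟩
      · simpa [disc, abs_of_pos h0] using h1
      · simpa using h0.ne'
  rw [h]
  refine (isPreconnected_Ioo.prod isPreconnected_univ).image _ (Continuous.continuousOn ?_)
  fun_prop

theorem isOpen_disc : IsOpen disc := Metric.isOpen_ball

theorem isOpen_disc_diff_zero : IsOpen (disc \ {0}) := isOpen_disc.sdiff isClosed_singleton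

theorem isOpen_ellipsoid {n : ℕ} (a : Fin n → ℝ) : IsOpen (ellipsoid a) :=
  isOpen_lt (by fun_prop) continuous_const

theorem convex_ellipsoid {n : ℕ} (a : Fin n → ℝ) (ha : ∀ i, 0 < a i) : Convex ℝ (ellipsoid a) := by
  have h : ConvexOn ℝ Set.univ fun z : Fin n → ℂ => ∑ i, ‖z i‖ ^ 2 / a i := by
    refine ⟨convex_univ, fun x _ y _ s t hs ht hst => ?_⟩
    simp only [smul_eq_mul, Finset.mul_sum, ← Finset.sum_add_distrib]
    refine Finset.sum_le_sum fun i _ => ?_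
    have h1 : ‖(s • x + t • y) i‖ ≤ s * ‖x i‖ + t * ‖y i‖ := by
      refine (norm_add_le _ _).trans_eq ?_
      simp [abs_of_nonneg hs, abs_of_nonneg ht]
    have h2 : (s * ‖x i‖ + t * ‖y i‖) ^ 2 ≤ s * ‖x i‖ ^ 2 + t * ‖y i‖ ^ 2 := by
      simpa using (convexOn_pow 2).2 (norm_nonneg (x i)) (norm_nonneg (y i)) hs ht hst
    rw [← mul_div_assoc, ← mul_div_assoc, ← add_div]
    exact div_le_div_of_nonneg_right ((pow_le_pow_left₀ (norm_nonneg _) h1 2).trans h2) (ha i).le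
  have := h.convex_lt 1
  simpa [ellipsoid] using this

/-! ### Splitting an admissible form into base and fibre parts -/

/-- A `1`-form on the total space as a map into the dual space. -/
noncomputable def toDual {n : ℕ} (α : Total n → Total n [⋀^Fin 1]→L[ℝ] ℝ) :
    Total n → Total n →L[ℝ] ℝ :=
  fun p => (oneFormEquiv (Total n)).symm (α p)

theorem oneFormEquiv_toDual {n : ℕ} (α : Total n → Total n [⋀^Fin 1]→L[ℝ] ℝ)
    (p : Total n) : oneFormEquiv (Total n) (toDual α p) = α p :=
  (oneFormEquiv (Total n)).apply_symm_apply (α p)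

namespace IsAdmissible

variable {n : ℕ} {U : Set (Fin n → ℂ)} {k : ℝ} {α : Total n → Total n [⋀^Fin 1]→L[ℝ] ℝ}

theorem contDiffOn_toDual (hα : IsAdmissible U k α) :
    ContDiffOn ℝ ∞ (toDual α) (U ×ˢ (disc \ {0})) :=
  (oneFormEquiv (Total n)).symm.contDiff.comp_contDiffOn hα.smooth

theorem toDual_inr (hα : IsAdmissible U k α) {z : Fin n → ℂ} (hz : z ∈ U) {w : ℂ}
    (hw : w ∈ disc \ {0}) (η : ℂ) : toDual α (z, w) (0, η) = 1 / k * (w⁻¹ * η).im := by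
  have h := congrArg (fun f => f fun _ => η) (hα.restrict z hz w hw)
  simp only [fibreRestrict, ← oneFormEquiv_toDual α] at h
  simpa [oneFormEquiv_apply, angularForm_apply] using h

theorem fderiv_toDual_sub (hU : IsOpen U) (hα : IsAdmissible U k α) {p : Total n}
    (hp : p ∈ U ×ˢ (disc \ {0})) (u v : Total n) :
    fderiv ℝ (toDual α) p u v - fderiv ℝ (toDual α) p v u = -(2 * liouville n u.1 v.1) := by
  have hd : DifferentiableAt ℝ (toDual α) p :=
    (hα.contDiffOn_toDual.differentiableOn (by simp)).differentiableAt
      ((hU.prod isOpen_disc_diff_zero).mem_nhds hp)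
  have h := extDeriv_oneFormEquiv_apply hd.hasFDerivAt ![u, v]
  simp only [oneFormEquiv_toDual] at h
  have h2 : extDeriv α p ![u, v] = (-pullStdForm n) ![u, v] := by rw [hα.d_eq p hp]
  rw [h] at h2
  simpa [pullStdForm, stdForm_eq_liouville] using h2

theorem hasFDerivAt_toDual_apply (hU : IsOpen U) (hα : IsAdmissible U k α) {p : Total n}
    (hp : p ∈ U ×ˢ (disc \ {0})) (v : Total n) :
    HasFDerivAt (fun q => toDual α q v) ((fderiv ℝ (toDual α) p).flip v) p := by
  have hd : DifferentiableAt ℝ (toDual α) p :=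
    (hα.contDiffOn_toDual.differentiableOn (by simp)).differentiableAt
      ((hU.prod isOpen_disc_diff_zero).mem_nhds hp)
  have := ((ContinuousLinearMap.apply ℝ ℝ v).hasFDerivAt).comp p hd.hasFDerivAt
  exact this

/-- The mixed component of dα vanishes, since π^*ω_st kills fibre vectors. The fibre component of α
does not depend on z, so its base derivative is zero. What remains is that the base component has
zero derivative along the fibre, and the punctured disc is connected. -/
theorem toDual_inl_eq (hU : IsOpen U) (hα : IsAdmissible U k α) {z : Fin n → ℂ} (hz : z ∈ U)
    {w w' : ℂ} (hw : w ∈ disc \ {0}) (hw' : w' ∈ disc \ {0}) (ζ : Fin n → ℂ) :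
    toDual α (z, w) (ζ, 0) = toDual α (z, w') (ζ, 0) := by
  have key : ∀ x ∈ disc \ {0},
      HasFDerivAt (fun y => toDual α (z, y) (ζ, 0)) (0 : ℂ →L[ℝ] ℝ) x := by
    intro x hx
    have hp : (z, x) ∈ U ×ˢ (disc \ {0}) := ⟨hz, hx⟩
    have h1 := (hα.hasFDerivAt_toDual_apply hU hp (ζ, 0)).comp x (hasFDerivAt_prodMk_right z x)
    refine h1.congr_fderiv ?_
    ext1 η
    have h2 := hα.fderiv_toDual_sub hU hp (0, η) (ζ, 0)
    have h3 : fderiv ℝ (toDual α) (z, x) (ζ, 0) (0, η) = 0 := by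
      have h4 := (hα.hasFDerivAt_toDual_apply hU hp (0, η)).comp
        (f := fun y => (y, x)) z (hasFDerivAt_prodMk_left z x)
      have h5 : HasFDerivAt (fun y => toDual α (y, x) (0, η)) (0 : (Fin n → ℂ) →L[ℝ] ℝ) z := by
        refine (hasFDerivAt_const (1 / k * (x⁻¹ * η).im) z).congr_of_eventuallyEq ?_
        filter_upwards [hU.mem_nhds hz] with y hy
        exact hα.toDual_inr hy hx η
      have h6 := congrArg (fun f => f ζ) (h4.unique h5)
      simpa using h6
    simp only [h3, map_zero, sub_zero, zero_apply, mul_zero, neg_zero] at h2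
    simpa using h2
  refine isOpen_disc_diff_zero.is_const_of_fderiv_eq_zero (𝕜 := ℝ) isPreconnected_disc_diff_zero
    (f := fun y => toDual α (z, y) (ζ, 0))
    (fun x hx => (key x hx).differentiableAt.differentiableWithinAt)
    (fun x hx => (key x hx).fderiv) hw hw'

/-- An admissible form splits as the sum of the angular form and of a form `β` on the base, whose
exterior derivative is minus the standard form. -/
theorem exists_base_form (hU : IsOpen U) (hα : IsAdmissible U k α) :
    ∃ β : (Fin n → ℂ) → (Fin n → ℂ) →L[ℝ] ℝ, ContDiffOn ℝ ∞ β U ∧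
      (∀ z ∈ U, ∀ w ∈ disc \ {0}, ∀ u : Total n,
        toDual α (z, w) u = β z u.1 + 1 / k * (w⁻¹ * u.2).im) ∧
      ∀ z ∈ U, ∀ u v, fderiv ℝ β z u v - fderiv ℝ β z v u = -(2 * liouville n u v) := by
  -- Any point of the punctured disc would do: β is α restricted to the slice w = 1/2.
  have hc : (1 / 2 : ℂ) ∈ disc \ {0} := by
    constructor
    · simp [disc]; norm_num
    · simp
  let i : (Fin n → ℂ) →L[ℝ] Total n := ContinuousLinearMap.inl ℝ (Fin n → ℂ) ℂ
  refine ⟨fun z => (toDual α (z, 1 / 2)).comp i, ?_, ?_, ?_⟩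
  · have h1 : ContDiffOn ℝ ∞ (fun z : Fin n → ℂ => toDual α (z, 1 / 2)) U :=
      hα.contDiffOn_toDual.comp (f := fun z : Fin n → ℂ => (z, (1 / 2 : ℂ)))
        (by fun_prop) fun z hz => ⟨hz, hc⟩
    exact h1.clm_comp contDiffOn_const
  · intro z hz w hw u
    have h : u = (u.1, 0) + (0, u.2) := by simp
    rw [h, map_add, hα.toDual_inr hz hw, hα.toDual_inl_eq hU hz hw hc]
    simp [i]
  · intro z hz u v
    have hp : (z, (1 / 2 : ℂ)) ∈ U ×ˢ (disc \ {0}) := ⟨hz, hc⟩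
    have hd : DifferentiableAt ℝ (toDual α) (z, 1 / 2) :=
      (hα.contDiffOn_toDual.differentiableOn (by simp)).differentiableAt
        ((hU.prod isOpen_disc_diff_zero).mem_nhds hp)
    have h1 : HasFDerivAt (fun z => toDual α (z, 1 / 2))
      ((fderiv ℝ (toDual α) (z, 1 / 2)).comp i) z :=
        hd.hasFDerivAt.comp (f := fun z => (z, 1 / 2)) z (hasFDerivAt_prodMk_left z _)
    have h2 := h1.clm_comp (hasFDerivAt_const i z)
    rw [h2.fderiv]
    have := hα.fderiv_toDual_sub hU hp (u, 0) (v, 0)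
    simpa [i] using this

end IsAdmissible

/-! ### Smooth extension of r²α, the function h, and the form ω -/

theorem dotForm_self (w : ℂ) : dotForm w w = ‖w‖ ^ 2 := by
  rw [dotForm_apply, Complex.sq_norm, Complex.normSq_apply]

theorem hasFDerivAt_norm_sq (w : ℂ) :
    HasFDerivAt (fun w : ℂ => ‖w‖ ^ 2) ((2 : ℝ) • dotForm w) w := by
  have h := dotForm.hasFDerivAt (x := w) |>.clm_apply (hasFDerivAt_id w)
  simp only [id, dotForm_self] at h
  refine h.congr_fderiv ?_
  ext η
  simp [dotForm_apply]
  ring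

/-- This is r² dθ = x dy - y dx: the factor r² removes the singularity of dθ at the origin. -/
theorem norm_sq_mul_im_inv_mul {w : ℂ} (hw : w ≠ 0) (η : ℂ) :
    ‖w‖ ^ 2 * (w⁻¹ * η).im = areaForm w η := by
  have h : Complex.normSq w ≠ 0 := by simpa using hw
  rw [Complex.sq_norm, areaForm_apply, Complex.mul_im, Complex.inv_re, Complex.inv_im]
  field_simp
  ring

/-- The Poincaré lemma on a convex set. By skew-symmetry, antisymmetrizing the derivative of
`liouville n` gives twice the bilinear form, which cancels dβ. -/
theorem exists_primitive {n : ℕ} {U : Set (Fin n → ℂ)} (hU : IsOpen U) (hUc : Convex ℝ U) (k : ℝ)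
    {β : (Fin n → ℂ) → (Fin n → ℂ) →L[ℝ] ℝ} (hβ : ContDiffOn ℝ ∞ β U)
    (hdβ : ∀ z ∈ U, ∀ u v, fderiv ℝ β z u v - fderiv ℝ β z v u = -(2 * liouville n u v)) :
    ∃ h : (Fin n → ℂ) → ℝ, ContDiffOn ℝ ∞ h U ∧
      ∀ z ∈ U, HasFDerivAt h (k • (β z + liouville n z)) z := by
  have hs : ContDiffOn ℝ ∞ (fun z => k • (β z + liouville n z)) U :=
    (hβ.add (liouville n).contDiff.contDiffOn).const_smul k
  have hd : DifferentiableOn ℝ (fun z => k • (β z + liouville n z)) U :=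
    hs.differentiableOn (by simp)
  obtain ⟨h, hh⟩ := hUc.exists_forall_hasFDerivAt_of_fderiv_symmetric hU hd fun z hz u v => by
    have h1 : HasFDerivAt (fun z => k • (β z + liouville n z))
        (k • (fderiv ℝ β z + liouville n)) z :=
      ((((hβ.differentiableOn (by simp)).differentiableAt (hU.mem_nhds hz)).hasFDerivAt).add
        (liouville n).hasFDerivAt).const_smul k
    rw [h1.fderiv]
    simp only [smul_apply, add_apply, smul_eq_mul]
    linear_combination k * hdβ z hz u v - k * liouville_swap n v u
  refine ⟨h, (contDiffOn_infty_iff_fderiv_of_isOpen hU).2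
    ⟨fun z hz => (hh z hz).differentiableAt.differentiableWithinAt,
      hs.congr fun z hz => (hh z hz).fderiv⟩, hh⟩

/-- The smooth extension of `r²α` across the zero section, where `α = β + (1/k) dθ`. -/
noncomputable def radialDual {n : ℕ} (k : ℝ) (β : (Fin n → ℂ) → (Fin n → ℂ) →L[ℝ] ℝ) :
    Total n → Total n →L[ℝ] ℝ :=
  fun p => ‖p.2‖ ^ 2 • (β p.1).comp (ContinuousLinearMap.fst ℝ (Fin n → ℂ) ℂ)
    + (1 / k) • (areaForm p.2).comp (ContinuousLinearMap.snd ℝ (Fin n → ℂ) ℂ)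

section

variable {n : ℕ} {U : Set (Fin n → ℂ)} {k : ℝ} {α : Total n → Total n [⋀^Fin 1]→L[ℝ] ℝ}
  {β : (Fin n → ℂ) → (Fin n → ℂ) →L[ℝ] ℝ}

theorem contDiffOn_radialDual (k : ℝ) (hβ : ContDiffOn ℝ ∞ β U) :
    ContDiffOn ℝ ∞ (radialDual k β) (U ×ˢ disc) := by
  have h1 : ContDiffOn ℝ ∞ (fun p : Total n => β p.1) (U ×ˢ disc) :=
    hβ.comp contDiff_fst.contDiffOn fun p hp => hp.1
  have h2 : ContDiffOn ℝ ∞ (fun p : Total n => ‖p.2‖ ^ 2) (U ×ˢ disc) :=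
    (contDiff_snd.norm_sq ℝ).contDiffOn
  have h3 : ContDiffOn ℝ ∞ (fun p : Total n => areaForm p.2) (U ×ˢ disc) :=
    (areaForm.contDiff.comp contDiff_snd).contDiffOn
  exact (h2.smul (h1.clm_comp contDiffOn_const)).add
    ((h3.clm_comp contDiffOn_const).const_smul (1 / k))

theorem radialForm_eqOn (h : ∀ z ∈ U, ∀ w ∈ disc \ {0}, ∀ u : Total n,
      toDual α (z, w) u = β z u.1 + 1 / k * (w⁻¹ * u.2).im) :
    Set.EqOn (radialForm α) (fun p => oneFormEquiv (Total n) (radialDual k β p)) (U ×ˢ disc) := by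
  rintro ⟨z, w⟩ ⟨hz, hw⟩
  dsimp only [radialForm]
  rw [← oneFormEquiv_toDual α, ← map_smul]
  refine congrArg _ (ContinuousLinearMap.ext fun u => ?_)
  -- On the zero section α is arbitrary, but the factor ‖w‖² makes both sides vanish.
  rcases eq_or_ne w 0 with rfl | hw0
  · simp [radialDual]
  · simp only [radialDual, smul_apply, add_apply, smul_eq_mul, h z hz w ⟨hw, hw0⟩ u,
      ContinuousLinearMap.comp_apply, ContinuousLinearMap.coe_fst', ContinuousLinearMap.coe_snd']
    rw [← norm_sq_mul_im_inv_mul hw0]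
    ring

theorem fderiv_radialDual_apply (k : ℝ) {p : Total n} (hβ : DifferentiableAt ℝ β p.1) :
    DifferentiableAt ℝ (radialDual k β) p ∧ ∀ u v, fderiv ℝ (radialDual k β) p u v =
      2 * dotForm p.2 u.2 * β p.1 v.1 + ‖p.2‖ ^ 2 * fderiv ℝ β p.1 u.1 v.1
        + 1 / k * areaForm u.2 v.2 := by
  have h1 : HasFDerivAt (fun q : Total n => β q.1) _ p := hβ.hasFDerivAt.comp p hasFDerivAt_fst
  have h2 : HasFDerivAt (fun q : Total n => ‖q.2‖ ^ 2) _ p :=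
    (hasFDerivAt_norm_sq p.2).comp p hasFDerivAt_snd
  have h3 : HasFDerivAt (fun q : Total n => areaForm q.2) _ p :=
    areaForm.hasFDerivAt.comp p hasFDerivAt_snd
  have h : HasFDerivAt (radialDual k β) _ p :=
    (h2.smul (h1.clm_comp (hasFDerivAt_const (ContinuousLinearMap.fst ℝ (Fin n → ℂ) ℂ) p))).add
    ((h3.clm_comp (hasFDerivAt_const (ContinuousLinearMap.snd ℝ (Fin n → ℂ) ℂ) p)).const_smul
      (1 / k))
  refine ⟨h.differentiableAt, fun u v => ?_⟩
  rw [h.fderiv]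
  simp
  ring

/-- In classical notation ω = (1 - r²) π^*ω_st + (2/k) dx ∧ dy + d(r²) ∧ β; the term -r² π^*ω_st is
r² dβ. -/
theorem bundleForm_apply (hU : IsOpen U) (hβ : ContDiffOn ℝ ∞ β U)
    (h : ∀ z ∈ U, ∀ w ∈ disc \ {0}, ∀ u : Total n,
      toDual α (z, w) u = β z u.1 + 1 / k * (w⁻¹ * u.2).im)
    (hdβ : ∀ z ∈ U, ∀ u v, fderiv ℝ β z u v - fderiv ℝ β z v u = -(2 * liouville n u v))
    {p : Total n} (hp : p ∈ U ×ˢ disc) (v : Fin 2 → Total n) :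
    bundleForm α p v = 2 * (1 - ‖p.2‖ ^ 2) * liouville n (v 0).1 (v 1).1
      + 2 / k * areaForm (v 0).2 (v 1).2
      + 2 * dotForm p.2 (v 0).2 * β p.1 (v 1).1 - 2 * dotForm p.2 (v 1).2 * β p.1 (v 0).1 := by
  obtain ⟨h1, h2⟩ := fderiv_radialDual_apply k (p := p)
    ((hβ.differentiableOn (by simp)).differentiableAt (hU.mem_nhds hp.1))
  have h3 := ((radialForm_eqOn h).eventuallyEq_of_mem
    ((hU.prod isOpen_disc).mem_nhds hp)).extDeriv_eq
  have h4 : areaForm (v 1).2 (v 0).2 = -areaForm (v 0).2 (v 1).2 := by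
    simp only [areaForm_apply]; ring
  simp only [bundleForm, ContinuousAlternatingMap.add_apply]
  rw [h3, extDeriv_oneFormEquiv_apply h1.hasFDerivAt, h2, h2, h4, pullStdForm,
    ContinuousAlternatingMap.compContinuousLinearMap_apply, stdForm_eq_liouville]
  simp only [Function.comp, ContinuousLinearMap.coe_fst']
  linear_combination ‖p.2‖ ^ 2 * hdβ p.1 hp.1 (v 0).1 (v 1).1

theorem contDiffOn_bundleForm (hU : IsOpen U)
    (hα : ContDiffOn ℝ ∞ (radialForm α) (U ×ˢ disc)) :
    ContDiffOn ℝ ∞ (bundleForm α) (U ×ˢ disc) :=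
  contDiffOn_const.add (contDiffOn_extDeriv (hU.prod isOpen_disc) hα)

theorem extDeriv_bundleForm (hU : IsOpen U)
    (hα : ContDiffOn ℝ ∞ (radialForm α) (U ×ˢ disc)) {p : Total n} (hp : p ∈ U ×ˢ disc) :
    extDeriv (bundleForm α) p = 0 := by
  have ho := hU.prod isOpen_disc
  have h1 : DifferentiableAt ℝ (extDeriv (radialForm α)) p :=
    ((contDiffOn_extDeriv ho hα).differentiableOn (by simp)).differentiableAt (ho.mem_nhds hp)
  have h2 : extDeriv (fun _ : Total n => pullStdForm n) p = 0 := by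
    ext v
    rw [extDeriv_apply (differentiableAt_const _)]
    simp
  have h3 : extDeriv (extDeriv (radialForm α)) p = 0 :=
    extDeriv_extDeriv_apply (hα.contDiffAt (ho.mem_nhds hp)) (by
      rw [minSmoothness_of_isRCLikeNormedField]; exact WithTop.coe_le_coe.2 (le_top : (2 : ℕ∞) ≤ ⊤))
  have h4 : extDeriv (bundleForm α) p = _ := extDeriv_fun_add (differentiableAt_const _) h1
  rw [h4, h2, h3, add_zero]

end

/-! ### Transport of nondegeneracy -/

/-- A symplectomorphism onto an open set with a nondegenerate form has a nondegenerate domain. -/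
theorem IsSymplectomorphism.nondegenerate {E F : Type*} [NormedAddCommGroup E] [NormedSpace ℝ E]
    [NormedAddCommGroup F] [NormedSpace ℝ F] {U : Set E} {τ : E → E [⋀^Fin 2]→L[ℝ] ℝ}
    {V : Set F} {σ : F → F [⋀^Fin 2]→L[ℝ] ℝ} {Φ : E → F} (hΦ : IsSymplectomorphism U τ V σ Φ)
    (hU : IsOpen U) (hV : IsOpen V)
    (hσ : ∀ q ∈ V, ∀ u : F, (∀ v : F, σ q ![u, v] = 0) → u = 0) {p : E} (hp : p ∈ U) (u : E)
    (hu : ∀ v : E, τ p ![u, v] = 0) : u = 0 := by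
  obtain ⟨Ψ, ⟨hl, hr⟩, hΨ⟩ := hΦ.smooth_inverse
  have hq : Φ p ∈ V := hΦ.bijOn.mapsTo hp
  have hΦd : HasFDerivAt Φ (fderiv ℝ Φ p) p :=
    ((hΦ.smooth.differentiableOn (by simp)).differentiableAt (hU.mem_nhds hp)).hasFDerivAt
  have hΨd : HasFDerivAt Ψ (fderiv ℝ Ψ (Φ p)) (Φ p) :=
    ((hΨ.differentiableOn (by simp)).differentiableAt (hV.mem_nhds hq)).hasFDerivAt
  have h1 : (fderiv ℝ Ψ (Φ p)).comp (fderiv ℝ Φ p) = ContinuousLinearMap.id ℝ E :=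
    (hΨd.comp p hΦd).unique ((hasFDerivAt_id p).congr_of_eventuallyEq
      (Filter.eventuallyEq_of_mem (hU.mem_nhds hp) hl))
  have hΦd' : HasFDerivAt Φ (fderiv ℝ Φ p) (Ψ (Φ p)) := by rwa [hl hp]
  have h2 : (fderiv ℝ Φ p).comp (fderiv ℝ Ψ (Φ p)) = ContinuousLinearMap.id ℝ F :=
    (hΦd'.comp (Φ p) hΨd).unique ((hasFDerivAt_id (Φ p)).congr_of_eventuallyEq
      (Filter.eventuallyEq_of_mem (hV.mem_nhds hq) hr))
  have h3 : fderiv ℝ Φ p u = 0 := by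
    refine hσ _ hq _ fun v => ?_
    -- The derivative of Ψ is a right inverse of that of Φ, so these test vectors realize every v in
    -- the target.
    have h4 := hu (fderiv ℝ Ψ (Φ p) v)
    rw [← hΦ.pullback p hp, ContinuousAlternatingMap.compContinuousLinearMap_apply] at h4
    have h5 : fderiv ℝ Φ p (fderiv ℝ Ψ (Φ p) v) = v := congrArg (fun f => f v) h2
    rw [← h4]
    congr 1
    ext i
    fin_cases i <;> simp [h5]
  have h6 := congrArg (fun f => f u) h1
  simpa [h3] using h6.symm

/-! ### The map Φ and its pull-back of the standard form -/

section

variable {n : ℕ} {U : Set (Fin n → ℂ)} {k : ℝ} {h : (Fin n → ℂ) → ℝ}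

theorem bundleMap_castSucc (k : ℝ) (h : (Fin n → ℂ) → ℝ) (p : Total n) (i : Fin n) :
    bundleMap k h p i.castSucc = √(1 - ‖p.2‖ ^ 2) • p.1 i := by
  rw [bundleMap, Fin.snoc_castSucc, Complex.real_smul]

theorem bundleMap_last (k : ℝ) (h : (Fin n → ℂ) → ℝ) (p : Total n) :
    bundleMap k h p (Fin.last n) = (1 / √k) • (Complex.exp (Complex.I * (h p.1 : ℂ)) * p.2) := by
  rw [bundleMap, Fin.snoc_last, Complex.real_smul, mul_assoc]

theorem one_sub_norm_sq_pos {w : ℂ} (hw : w ∈ disc) : 0 < 1 - ‖w‖ ^ 2 := by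
  have h1 : ‖w‖ < 1 := by simpa [disc] using hw
  nlinarith [norm_nonneg w]

theorem hasFDerivAt_bundleMap_castSucc (k : ℝ) (h : (Fin n → ℂ) → ℝ) {p : Total n}
    (hp : p.2 ∈ disc) (i : Fin n) :
    ∃ D : Total n →L[ℝ] ℂ, HasFDerivAt (fun q => bundleMap k h q i.castSucc) D p ∧
      ∀ u : Total n, D u = √(1 - ‖p.2‖ ^ 2) • u.1 i
        - (dotForm p.2 u.2 / √(1 - ‖p.2‖ ^ 2)) • p.1 i := by
  have h1 : HasFDerivAt (fun q : Total n => √(1 - ‖q.2‖ ^ 2)) _ p :=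
    (((hasFDerivAt_norm_sq p.2).comp p hasFDerivAt_snd).const_sub 1).sqrt
      (one_sub_norm_sq_pos hp).ne'
  have h2 : HasFDerivAt (fun q : Total n => q.1 i) _ p :=
    (hasFDerivAt_apply (𝕜 := ℝ) i p.1).comp p hasFDerivAt_fst
  simp only [bundleMap_castSucc]
  refine ⟨_, h1.smul h2, fun u => ?_⟩
  simp
  ring

theorem hasFDerivAt_bundleMap_last (k : ℝ) {h' : (Fin n → ℂ) →L[ℝ] ℝ} {p : Total n}
    (hh : HasFDerivAt h h' p.1) :
    ∃ D : Total n →L[ℝ] ℂ, HasFDerivAt (fun q => bundleMap k h q (Fin.last n)) D p ∧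
      ∀ u : Total n, D u = (1 / √k) • (Complex.exp (Complex.I * (h p.1 : ℂ)) *
        (u.2 + h' u.1 * Complex.I * p.2)) := by
  have h1 : HasFDerivAt (fun q : Total n => Complex.I * (h q.1 : ℂ)) _ p :=
    (Complex.ofRealCLM.hasFDerivAt.comp p (hh.comp p hasFDerivAt_fst)).const_mul Complex.I
  have h2 : HasFDerivAt (fun q : Total n => q.2)
    (ContinuousLinearMap.snd ℝ (Fin n → ℂ) ℂ) p := hasFDerivAt_snd
  simp only [bundleMap_last]
  refine ⟨_, (h1.cexp.mul h2).const_smul (1 / √k), fun u => ?_⟩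
  simp
  ring

theorem fderiv_bundleMap_apply (k : ℝ) {h' : (Fin n → ℂ) →L[ℝ] ℝ} {p : Total n}
    (hp : p.2 ∈ disc) (hh : HasFDerivAt h h' p.1) (u : Total n) :
    (fun i => fderiv ℝ (bundleMap k h) p u (Fin.castSucc i)) =
        √(1 - ‖p.2‖ ^ 2) • u.1 - (dotForm p.2 u.2 / √(1 - ‖p.2‖ ^ 2)) • p.1 ∧
      fderiv ℝ (bundleMap k h) p u (Fin.last n) = (1 / √k) •
        (Complex.exp (Complex.I * (h p.1 : ℂ)) * (u.2 + h' u.1 * Complex.I * p.2)) := by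
  have hd : ∀ i, DifferentiableAt ℝ (fun q => bundleMap k h q i) p := by
    intro i
    induction i using Fin.lastCases with
    | last => exact (hasFDerivAt_bundleMap_last k hh).choose_spec.1.differentiableAt
    | cast i => exact (hasFDerivAt_bundleMap_castSucc k h hp i).choose_spec.1.differentiableAt
  have key : ∀ i, fderiv ℝ (bundleMap k h) p u i = fderiv ℝ (fun q => bundleMap k h q i) p u := by
    intro i
    rw [fderiv_apply (differentiableAt_pi.2 hd) i]
    rfl
  constructor
  · funext i
    obtain ⟨D, hD, hDu⟩ := hasFDerivAt_bundleMap_castSucc k h hp i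
    rw [key, hD.fderiv, hDu]
    rfl
  · obtain ⟨D, hD, hDu⟩ := hasFDerivAt_bundleMap_last k hh
    rw [key, hD.fderiv, hDu]

theorem areaForm_mul_left {c : ℂ} (hc : ‖c‖ = 1) (w η : ℂ) :
    areaForm (c * w) (c * η) = areaForm w η := by
  have h : c.re * c.re + c.im * c.im = 1 := by
    rw [← Complex.normSq_apply, ← Complex.sq_norm, hc, one_pow]
  simp only [areaForm_apply, Complex.mul_re, Complex.mul_im]
  linear_combination (w.re * η.im - w.im * η.re) * h

theorem stdForm_fderiv_bundleMap (hk : 0 < k) {h' : (Fin n → ℂ) →L[ℝ] ℝ} {p : Total n}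
    (hp : p.2 ∈ disc) (hh : HasFDerivAt h h' p.1) (v : Fin 2 → Total n) :
    (stdForm (n + 1)).compContinuousLinearMap (fderiv ℝ (bundleMap k h) p) v =
      2 * (1 - ‖p.2‖ ^ 2) * liouville n (v 0).1 (v 1).1 + 2 / k * areaForm (v 0).2 (v 1).2
      + 2 * dotForm p.2 (v 0).2 * (h' (v 1).1 / k - liouville n p.1 (v 1).1)
      - 2 * dotForm p.2 (v 1).2 * (h' (v 0).1 / k - liouville n p.1 (v 0).1) := by
  rw [ContinuousAlternatingMap.compContinuousLinearMap_apply, stdForm_succ]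
  simp only [Function.comp]
  rw [(fderiv_bundleMap_apply k hp hh (v 0)).1, (fderiv_bundleMap_apply k hp hh (v 1)).1,
    (fderiv_bundleMap_apply k hp hh (v 0)).2, (fderiv_bundleMap_apply k hp hh (v 1)).2]
  have hs : √(1 - ‖p.2‖ ^ 2) ^ 2 = 1 - ‖p.2‖ ^ 2 := Real.sq_sqrt (one_sub_norm_sq_pos hp).le
  have hs0 : √(1 - ‖p.2‖ ^ 2) ≠ 0 := (Real.sqrt_pos.2 (one_sub_norm_sq_pos hp)).ne'
  have hk2 : (1 / √k) ^ 2 = 1 / k := by rw [div_pow, Real.sq_sqrt hk.le, one_pow]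
  have hc : ‖Complex.exp (Complex.I * (h p.1 : ℂ))‖ = 1 := Complex.norm_exp_I_mul_ofReal _
  -- The term pairing p.1 with itself vanishes, and in the cross terms the square root cancels
  -- against its inverse from the derivative.
  have e1 : liouville n
      (√(1 - ‖p.2‖ ^ 2) • (v 0).1 - (dotForm p.2 (v 0).2 / √(1 - ‖p.2‖ ^ 2)) • p.1)
      (√(1 - ‖p.2‖ ^ 2) • (v 1).1 - (dotForm p.2 (v 1).2 / √(1 - ‖p.2‖ ^ 2)) • p.1) =
      √(1 - ‖p.2‖ ^ 2) ^ 2 * liouville n (v 0).1 (v 1).1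
        + dotForm p.2 (v 1).2 * liouville n p.1 (v 0).1
        - dotForm p.2 (v 0).2 * liouville n p.1 (v 1).1 := by
    simp only [map_sub, map_smul, sub_apply, smul_apply, smul_eq_mul, liouville_self,
      liouville_swap n (v 0).1 p.1]
    field_simp
    ring
  have e2 : ∀ x y : ℂ, areaForm ((1 / √k) • x) ((1 / √k) • y) = 1 / k * areaForm x y := by
    intro x y
    rw [← hk2]
    simp only [map_smul, smul_apply, smul_eq_mul]
    ring
  -- Here `areaForm η (I * w) = dotForm w η`, so the rotation by h contributes multiples of d(r²) ∧
  -- dh; the term with iw in both slots is zero.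
  have e3 : areaForm ((v 0).2 + h' (v 0).1 * Complex.I * p.2)
      ((v 1).2 + h' (v 1).1 * Complex.I * p.2) = areaForm (v 0).2 (v 1).2
        + dotForm p.2 (v 0).2 * h' (v 1).1 - dotForm p.2 (v 1).2 * h' (v 0).1 := by
    simp [areaForm_apply, dotForm_apply]
    ring
  rw [e1, e2, areaForm_mul_left hc, e3, hs]
  ring

theorem contDiffOn_bundleMap (k : ℝ) (hh : ContDiffOn ℝ ∞ h U) :
    ContDiffOn ℝ ∞ (bundleMap k h) (U ×ˢ disc) := by
  rw [contDiffOn_pi]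
  intro i
  induction i using Fin.lastCases with
  | last =>
    simp only [bundleMap_last]
    have h1 : ContDiffOn ℝ ∞ (fun p : Total n => h p.1) (U ×ˢ disc) :=
      hh.comp contDiff_fst.contDiffOn fun p hp => hp.1
    have h2 : ContDiffOn ℝ ∞ (fun p : Total n => (h p.1 : ℂ)) (U ×ˢ disc) :=
      Complex.ofRealCLM.contDiff.comp_contDiffOn h1
    exact ((contDiffOn_const.mul h2).cexp.mul contDiff_snd.contDiffOn).const_smul _
  | cast i =>
    simp only [bundleMap_castSucc]
    have h1 : ContDiffOn ℝ ∞ (fun p : Total n => √(1 - ‖p.2‖ ^ 2)) (U ×ˢ disc) :=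
      (contDiff_const.sub (contDiff_snd.norm_sq ℝ)).contDiffOn.sqrt
        fun p hp => (one_sub_norm_sq_pos hp.2).ne'
    have h2 : ContDiff ℝ ∞ (fun p : Total n => p.1 i) := by fun_prop
    exact h1.smul h2.contDiffOn

/-! ### The inverse of Φ and its image -/

/-- The base component of the inverse of `bundleMap k h`. -/
noncomputable def bundleInvBase (k : ℝ) (q : Fin (n + 1) → ℂ) : Fin n → ℂ :=
  fun i => (√(1 - k * ‖q (Fin.last n)‖ ^ 2))⁻¹ • q i.castSucc

/-- The inverse of `bundleMap k h`. -/
noncomputable def bundleInv (k : ℝ) (h : (Fin n → ℂ) → ℝ) (q : Fin (n + 1) → ℂ) : Total n :=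
  (bundleInvBase k q,
    √k • (Complex.exp (-(Complex.I * (h (bundleInvBase k q) : ℂ))) * q (Fin.last n)))

theorem mem_ellipsoid_snoc {a : Fin n → ℝ} {q : Fin (n + 1) → ℂ} :
    q ∈ ellipsoid (Fin.snoc (α := fun _ => ℝ) a (1 / k)) ↔
      ∑ i : Fin n, ‖q i.castSucc‖ ^ 2 / a i + k * ‖q (Fin.last n)‖ ^ 2 < 1 := by
  simp only [ellipsoid, Set.mem_ofPred_eq, Fin.sum_univ_castSucc, Fin.snoc_castSucc, Fin.snoc_last]
  rw [div_div_eq_mul_div, div_one, mul_comm k]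

/-- The phase has modulus one, so |w| can be read off the last coordinate without knowing h. This
makes Φ invertible in closed form: |w| gives z, then h(z) gives the phase, then w follows. -/
theorem norm_bundleMap_last_sq (hk : 0 < k) (h : (Fin n → ℂ) → ℝ) (p : Total n) :
    k * ‖bundleMap k h p (Fin.last n)‖ ^ 2 = ‖p.2‖ ^ 2 := by
  rw [bundleMap_last, norm_smul, norm_mul, Complex.norm_exp_I_mul_ofReal, one_mul, mul_pow,
    Real.norm_eq_abs, sq_abs, div_pow, Real.sq_sqrt hk.le]
  field_simp

theorem norm_bundleInv_snd_sq (hk : 0 < k) (h : (Fin n → ℂ) → ℝ) (q : Fin (n + 1) → ℂ) :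
    ‖(bundleInv k h q).2‖ ^ 2 = k * ‖q (Fin.last n)‖ ^ 2 := by
  have h1 : ‖Complex.exp (-(Complex.I * (h (bundleInvBase k q) : ℂ)))‖ = 1 := by
    rw [Complex.exp_neg, norm_inv, Complex.norm_exp_I_mul_ofReal, inv_one]
  rw [bundleInv, norm_smul, norm_mul, h1, one_mul, mul_pow, Real.norm_eq_abs, sq_abs,
    Real.sq_sqrt hk.le]

theorem one_sub_pos_of_mem_ellipsoid {a : Fin n → ℝ} (ha : ∀ i, 0 < a i) {q : Fin (n + 1) → ℂ}
    (hq : q ∈ ellipsoid (Fin.snoc (α := fun _ => ℝ) a (1 / k))) :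
    0 < 1 - k * ‖q (Fin.last n)‖ ^ 2 := by
  have h1 : 0 ≤ ∑ i : Fin n, ‖q i.castSucc‖ ^ 2 / a i :=
    Finset.sum_nonneg fun i _ => div_nonneg (sq_nonneg _) (ha i).le
  linarith [mem_ellipsoid_snoc.1 hq]

theorem sum_norm_smul_sq_div (a : Fin n → ℝ) (c : ℝ) (z : Fin n → ℂ) :
    ∑ i, ‖c • z i‖ ^ 2 / a i = c ^ 2 * ∑ i, ‖z i‖ ^ 2 / a i := by
  rw [Finset.mul_sum]
  refine Finset.sum_congr rfl fun i _ => ?_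
  rw [norm_smul, mul_pow, Real.norm_eq_abs, sq_abs, mul_div_assoc]

theorem mapsTo_bundleMap (hk : 0 < k) (h : (Fin n → ℂ) → ℝ) (a : Fin n → ℝ) :
    Set.MapsTo (bundleMap k h) (ellipsoid a ×ˢ disc)
      (ellipsoid (Fin.snoc (α := fun _ => ℝ) a (1 / k))) := by
  rintro p ⟨hz, hw⟩
  have h1 := one_sub_norm_sq_pos hw
  rw [mem_ellipsoid_snoc, norm_bundleMap_last_sq hk]
  simp only [bundleMap_castSucc]
  rw [sum_norm_smul_sq_div, Real.sq_sqrt h1.le]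
  have h2 : ∑ i, ‖p.1 i‖ ^ 2 / a i < 1 := hz
  -- One minus the left side is (1 - |w|²)(1 - ∑ |z_i|²/a_i), a product of positive factors.
  nlinarith

theorem mapsTo_bundleInvBase {a : Fin n → ℝ} (ha : ∀ i, 0 < a i) :
    Set.MapsTo (bundleInvBase k) (ellipsoid (Fin.snoc (α := fun _ => ℝ) a (1 / k)))
      (ellipsoid a) := by
  intro q hq
  have h1 := one_sub_pos_of_mem_ellipsoid ha hq
  have h2 := mem_ellipsoid_snoc.1 hq
  change ∑ i, ‖(√(1 - k * ‖q (Fin.last n)‖ ^ 2))⁻¹ • q i.castSucc‖ ^ 2 / a i < 1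
  rw [sum_norm_smul_sq_div a _ fun i => q i.castSucc, inv_pow, Real.sq_sqrt h1.le,
    inv_mul_lt_iff₀ h1]
  linarith

theorem mapsTo_bundleInv (hk : 0 < k) (h : (Fin n → ℂ) → ℝ) {a : Fin n → ℝ} (ha : ∀ i, 0 < a i) :
    Set.MapsTo (bundleInv k h) (ellipsoid (Fin.snoc (α := fun _ => ℝ) a (1 / k)))
      (ellipsoid a ×ˢ disc) := by
  intro q hq
  refine ⟨mapsTo_bundleInvBase ha hq, ?_⟩
  have h1 := one_sub_pos_of_mem_ellipsoid ha hq
  rw [← norm_bundleInv_snd_sq hk h] at h1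
  rw [disc, mem_ball_zero_iff]
  nlinarith [norm_nonneg (bundleInv k h q).2]

theorem invOn_bundleInv (hk : 0 < k) (h : (Fin n → ℂ) → ℝ) {a : Fin n → ℝ} (ha : ∀ i, 0 < a i) :
    Set.InvOn (bundleInv k h) (bundleMap k h) (ellipsoid a ×ˢ disc)
      (ellipsoid (Fin.snoc (α := fun _ => ℝ) a (1 / k))) := by
  have hk0 : √k ≠ 0 := (Real.sqrt_pos.2 hk).ne'
  constructor
  · intro p hp
    have h1 := (Real.sqrt_pos.2 (one_sub_norm_sq_pos hp.2)).ne'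
    have h2 : bundleInvBase k (bundleMap k h p) = p.1 := by
      funext i
      rw [bundleInvBase, norm_bundleMap_last_sq hk, bundleMap_castSucc, smul_smul,
        inv_mul_cancel₀ h1, one_smul]
    refine Prod.ext h2 ?_
    simp only [bundleInv, h2, bundleMap_last]
    rw [mul_smul_comm, smul_smul, mul_one_div_cancel hk0, one_smul, ← mul_assoc, ← Complex.exp_add,
      neg_add_cancel, Complex.exp_zero, one_mul]
  · intro q hq
    have h1 := (Real.sqrt_pos.2 (one_sub_pos_of_mem_ellipsoid ha hq)).ne'
    funext i
    induction i using Fin.lastCases with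
    | last =>
      simp only [bundleMap_last, bundleInv]
      rw [mul_smul_comm, smul_smul, one_div_mul_cancel hk0, one_smul, ← mul_assoc,
        ← Complex.exp_add, add_neg_cancel, Complex.exp_zero, one_mul]
    | cast i =>
      rw [bundleMap_castSucc, norm_bundleInv_snd_sq hk]
      simp only [bundleInv, bundleInvBase]
      rw [smul_smul, mul_inv_cancel₀ h1, one_smul]

theorem contDiffOn_bundleInv {a : Fin n → ℝ} (ha : ∀ i, 0 < a i)
    (hh : ContDiffOn ℝ ∞ h (ellipsoid a)) :
    ContDiffOn ℝ ∞ (bundleInv k h) (ellipsoid (Fin.snoc (α := fun _ => ℝ) a (1 / k))) := by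
  have hl : ContDiff ℝ ∞ fun q : Fin (n + 1) → ℂ => q (Fin.last n) := by fun_prop
  have h1 : ContDiffOn ℝ ∞ (fun q : Fin (n + 1) → ℂ => (√(1 - k * ‖q (Fin.last n)‖ ^ 2))⁻¹)
      (ellipsoid (Fin.snoc (α := fun _ => ℝ) a (1 / k))) :=
    ((contDiff_const.sub (contDiff_const.mul (hl.norm_sq ℝ))).contDiffOn.sqrt
      fun q hq => (one_sub_pos_of_mem_ellipsoid ha hq).ne').inv
      fun q hq => (Real.sqrt_pos.2 (one_sub_pos_of_mem_ellipsoid ha hq)).ne'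
  have h2 : ContDiffOn ℝ ∞ (bundleInvBase (n := n) k)
      (ellipsoid (Fin.snoc (α := fun _ => ℝ) a (1 / k))) := by
    rw [contDiffOn_pi]
    intro i
    have h3 : ContDiff ℝ ∞ fun q : Fin (n + 1) → ℂ => q i.castSucc := by fun_prop
    exact h1.smul h3.contDiffOn
  have h4 : ContDiffOn ℝ ∞ (fun q : Fin (n + 1) → ℂ => (h (bundleInvBase k q) : ℂ))
      (ellipsoid (Fin.snoc (α := fun _ => ℝ) a (1 / k))) :=
    Complex.ofRealCLM.contDiff.comp_contDiffOn (hh.comp h2 (mapsTo_bundleInvBase ha))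
  exact h2.prodMk (((contDiffOn_const.mul h4).neg.cexp.mul hl.contDiffOn).const_smul _)

end

end DiscBundle

/-! ### Assembly -/

theorem mainTheorem9 (n : ℕ) (a : Fin n → ℝ) (ha : ∀ i, 0 < a i) (k : ℝ) (hk : 0 < k)
    (α : DiscBundle.Total n → DiscBundle.Total n [⋀^Fin 1]→L[ℝ] ℝ)
    (hα : DiscBundle.IsAdmissible (DiscBundle.ellipsoid a) k α) :
    ContDiffOn ℝ ∞ (DiscBundle.radialForm α) (DiscBundle.ellipsoid a ×ˢ DiscBundle.disc) ∧
    DiscBundle.IsSymplecticOn (DiscBundle.bundleForm α)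
      (DiscBundle.ellipsoid a ×ˢ DiscBundle.disc) ∧
    ∃ h : (Fin n → ℂ) → ℝ, ContDiffOn ℝ ∞ h (DiscBundle.ellipsoid a) ∧
      DiscBundle.IsSymplectomorphism
        (DiscBundle.ellipsoid a ×ˢ DiscBundle.disc) (DiscBundle.bundleForm α)
        (DiscBundle.ellipsoid (Fin.snoc (α := fun _ => ℝ) a (1 / k)))
        (fun _ => DiscBundle.stdForm (n + 1))
        (DiscBundle.bundleMap k h) := by
  have hU := DiscBundle.isOpen_ellipsoid a
  obtain ⟨β, hβ, hαβ, hdβ⟩ := hα.exists_base_form hU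
  obtain ⟨h, hh, hh'⟩ :=
    DiscBundle.exists_primitive hU (DiscBundle.convex_ellipsoid a ha) k hβ hdβ
  have hr : ContDiffOn ℝ ∞ (DiscBundle.radialForm α)
      (DiscBundle.ellipsoid a ×ˢ DiscBundle.disc) :=
    ((DiscBundle.oneFormEquiv (DiscBundle.Total n)).contDiff.comp_contDiffOn
      (DiscBundle.contDiffOn_radialDual k hβ)).congr (DiscBundle.radialForm_eqOn hαβ)
  have hinv := DiscBundle.invOn_bundleInv hk h ha
  have hΦ : DiscBundle.IsSymplectomorphism
        (DiscBundle.ellipsoid a ×ˢ DiscBundle.disc) (DiscBundle.bundleForm α)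
        (DiscBundle.ellipsoid (Fin.snoc (α := fun _ => ℝ) a (1 / k)))
        (fun _ => DiscBundle.stdForm (n + 1))
        (DiscBundle.bundleMap k h) :=
    { bijOn := hinv.bijOn (DiscBundle.mapsTo_bundleMap hk h a)
        (DiscBundle.mapsTo_bundleInv hk h ha)
      smooth := DiscBundle.contDiffOn_bundleMap k hh
      smooth_inverse := ⟨_, hinv, DiscBundle.contDiffOn_bundleInv ha hh⟩
      pullback := fun p hp => by
        ext v
        rw [DiscBundle.stdForm_fderiv_bundleMap hk hp.2 (hh' p.1 hp.1),
          DiscBundle.bundleForm_apply hU hβ hαβ hdβ hp]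
        -- The choice of h enters here: dh/k - λ = β makes the two formulas for the 2-form coincide.
        have e : ∀ u, (k • (β p.1 + DiscBundle.liouville n p.1)) u / k
            - DiscBundle.liouville n p.1 u = β p.1 u := fun u => by
          simp only [smul_apply, add_apply, smul_eq_mul]
          field_simp
          ring
        rw [e, e] }
  exact ⟨hr,
    { smooth := DiscBundle.contDiffOn_bundleForm hU hr
      closed := fun p hp => DiscBundle.extDeriv_bundleForm hU hr hp
      nondegenerate := fun p hp => hΦ.nondegenerate (hU.prod DiscBundle.isOpen_disc)
        (DiscBundle.isOpen_ellipsoid _) (fun _ _ => DiscBundle.stdForm_nondegenerate _) hp },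
    h, hh, hΦ⟩
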